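/- Let $\mathcal X\subseteq\mathbb R^n$ be bounded, let $\mathcal H$ be a real Hilbert space, let $\Phi:\mathcal X\to\mathcal H$ be a feature map, and let $k(x,x')=\langle\Phi(x),\Phi(x')\rangle$ be its kernel. Suppose that 1. (smoothness) there are $\rho>0$ and a continuous non-decreasing $f:[0,\infty)\to[0,\infty)$ with $f(0)=0$ such that $k(x,x)+k(x',x')-2k(x,x')\le f(\|x-x'\|_2^2)$ for all $x,x'\in\mathcal X$ with $\|x-x'\|_2\le\rho$; 2. (universality) the functions $x\mapsto\langle w,\Phi(x)\rangle$, $w\in\mathcal H$, are dense in the set of continuous real functions on $\mathcal X$ for uniform convergence on $\mathcal X$. A classifier is a rule that assigns to every finite training set $T=\{(x_i,y_i)\}_{i=1}^m\subseteq\mathcal X\times\{-1,+1\}$ a measurable function $f_T:\mathcal X\to\mathbb R$. For a probability distribution $\mathbb P$ on $\mathcal X\times\{-1,+1\}$ and a measurable $g:\mathcal X\to\mathbb R$ put $\mathcal R_{\mathbb P}(g)=\mathbb P(\{(x,y):\operatorname{sign} g(x)\ne y\})$, where $\operatorname{sign}(t)=+1$ for $t\ge 0$ and $-1$ for $t<0$,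 and let $\mathcal R_{\mathbb P}=\inf\{\mathcal R_{\mathbb P}(g): g\text{ measurable}\}$ be the Bayes risk. A classifier is strongly uniformly consistent if for every such $\mathbb P$ and $(x_i,y_i)_{i\ge1}$ i.i.d. with law $\mathbb P$, almost surely $\lim_{m\to\infty}\mathcal R_{\mathbb P}(f_{T_m})=\mathcal R_{\mathbb P}$, where $T_m=\{(x_i,y_i)\}_{i=1}^m$. A kernel SVM with parameters $c(m)>0$ assigns to every training set of size $m$ the function $x\mapsto\langle w,\Phi(x)\rangle+b$ for some minimizer $(w,b)\in\mathcal H\times\mathbb R$ of $$c(m)\,\|w\|_{\mathcal H}+\frac1m\sum_{i=1}^m\max\bigl(1-y_i(\langle w,\Phi(x_i)\rangle+b),\,0\bigr).$$ Then the kernel SVM with $c\downarrow0$ sufficiently slowly is strongly uniformly consistent. That is, there is a non-increasing positive sequence $c_0(m)\to0$ (independent of $\mathbb P$) such that for every positive sequence $c(m)\to0$ with $c(m)\ge c_0(m)$ for all large $m$, a kernel SVM with parameters $c(m)$ exists (the minima are attained), and every such kernel SVM, whatever minimizers it selects, is strongly uniformly consistent. -/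

import Mathlib

open MeasureTheory Filter Topology
open scoped NNReal ENNReal

/-- The two labels `-1` and `+1`. -/
abbrev SVMLabel : Type := ({-1, 1} : Set ℝ)

noncomputable section

/-- The `{-1, +1}`-valued sign of a real number, with `sign 0 = +1`. -/
def labelSign (t : ℝ) : ℝ := if 0 ≤ t then 1 else -1

/-- A classifier: a rule that assigns a real function on the sample space to every
finite training set. Measurability of these functions is part of `StronglyUniformlyConsistent`. -/
abbrev Classifier (X : Type*) : Type _ := (m : ℕ) → (Fin m → X × SVMLabel) → X → ℝ

section Risk

variable {X : Type*} [MeasurableSpace X]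

/-- The risk of `g`: the probability that `sign (g x)` differs from the label of `x`. -/
def risk (P : Measure (X × SVMLabel)) (g : X → ℝ) : ℝ≥0∞ :=
  P {z | labelSign (g z.1) ≠ (z.2 : ℝ)}

/-- The Bayes risk: the infimum of the risks of all measurable real functions. -/
def bayesRisk (P : Measure (X × SVMLabel)) : ℝ≥0∞ :=
  ⨅ (g : X → ℝ) (_ : Measurable g), risk P g

/-- The classifier returns measurable functions and, for every distribution `P` of the labelled
samples, its risk after training on the first `m` terms of an i.i.d. sequence with law `P` tends
to the Bayes risk of `P`, almost surely. -/
def StronglyUniformlyConsistent (A : Classifier X) : Prop :=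
  (∀ (m : ℕ) (T : Fin m → X × SVMLabel), Measurable (A m T)) ∧
  ∀ (P : Measure (X × SVMLabel)) [IsProbabilityMeasure P],
    ∀ᵐ z ∂(Measure.infinitePi fun _ : ℕ => P),
      Tendsto (fun m : ℕ => risk P (A m fun i => z i)) atTop (𝓝 (bayesRisk P))

end Risk

section Kernel

variable {X : Type*} {H : Type*} [NormedAddCommGroup H] [InnerProductSpace ℝ H]

/-- The kernel `k (x, x') = ⟨Φ x, Φ x'⟩` of a feature map `Φ`. -/
def featureKernel (Φ : X → H) (x x' : X) : ℝ := inner ℝ (Φ x) (Φ x')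

/-- The objective function of the kernel SVM with parameter `c` on the training set `T`:
`c ‖w‖` plus the average hinge loss of `x ↦ ⟨w, Φ x⟩ + b` over the samples. -/
def svmObjective (Φ : X → H) (c : ℝ) {m : ℕ} (T : Fin m → X × SVMLabel) (p : H × ℝ) : ℝ :=
  c * ‖p.1‖ +
    (1 / (m : ℝ)) * ∑ i, max (1 - ((T i).2 : ℝ) * (inner ℝ p.1 (Φ (T i).1) + p.2)) 0

/-- `A` is a kernel SVM with parameter `c m` for training sets of size `m`: the function it
returns is given by a minimizer `(w, b)` of the SVM objective over `H × ℝ`. -/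
def IsKernelSVM (Φ : X → H) (c : ℕ → ℝ) (A : Classifier X) : Prop :=
  ∀ (m : ℕ) (T : Fin m → X × SVMLabel), ∃ p : H × ℝ,
    (∀ q : H × ℝ, svmObjective Φ (c m) T p ≤ svmObjective Φ (c m) T q) ∧
    A m T = fun x => inner ℝ p.1 (Φ x) + p.2

/-- Universality: the functions `x ↦ ⟨w, Φ x⟩` are dense in the continuous functions on `X`
for uniform convergence. -/
def IsUniversal [TopologicalSpace X] (Φ : X → H) : Prop :=
  ∀ (g : C(X, ℝ)) (ε : ℝ), 0 < ε → ∃ w : H, ∀ x : X, |inner ℝ w (Φ x) - g x| < ε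

/-- The smoothness condition on a kernel `k`. -/
def IsSmoothKernel [SeminormedAddCommGroup X] (S : Set X) (k : S → S → ℝ) : Prop :=
  ∃ (ρ : ℝ) (f : ℝ≥0 → ℝ≥0), 0 < ρ ∧ Continuous f ∧ Monotone f ∧ f 0 = 0 ∧
    ∀ x x' : S, ‖(x : X) - x'‖ ≤ ρ →
      k x x + k x' x' - 2 * k x x' ≤ (f (‖(x : X) - x'‖₊ ^ 2) : ℝ)

end Kernel

end

/-! The hinge loss is a surrogate for the error: the excess risk of a bounded function is at most
its excess hinge risk over the Bayes classifier `g₀` (`exists_bayes_classifier`), and by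
universality functions `⟨w, Φ x⟩` have hinge risk at most that of `g₀` plus any `ε > 0`
(`IsUniversal.exists_hingeRisk_le`). It remains to make empirical and true hinge risk close,
uniformly over the region where minimizers live. Comparison with `(0, 0)` gives `‖w‖ ≤ 1 / c`; the
unpenalized bias can be clipped without changing any sign or raising the loss.

The uniform closeness comes from discretization. Smoothness makes `Φ` uniformly continuous and `X`
is totally bounded, so labelled samples fall into finitely many cells with nearly constant features
(`exists_quantizer`), and only the cell frequencies matter. Hoeffding and Borel–Cantelli control
these almost surely (`ae_eventually_freq_dev_lt`). The cells depend on `Φ` alone, so `c₀` can be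
chosen, slow compared with their number, before `P` is given. -/

noncomputable section

/-! ### Labels and the hinge loss. -/

/-- The label `+1`. -/
def posLabel : SVMLabel := ⟨1, by simp⟩

/-- The label `-1`. -/
def negLabel : SVMLabel := ⟨-1, by simp⟩

@[simp] lemma coe_posLabel : (posLabel : ℝ) = 1 := rfl

@[simp] lemma coe_negLabel : (negLabel : ℝ) = -1 := rfl

lemma label_eq (y : SVMLabel) : y = posLabel ∨ y = negLabel := by
  rcases y with ⟨y, hy⟩
  rcases hy with rfl | hy
  · exact Or.inr rfl
  · exact Or.inl (Subtype.ext hy)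

lemma abs_label (y : SVMLabel) : |(y : ℝ)| = 1 := by
  rcases label_eq y with rfl | rfl <;> simp

instance : Finite SVMLabel := by
  unfold SVMLabel; infer_instance

lemma measurable_labelSign : Measurable labelSign :=
  Measurable.ite measurableSet_Ici measurable_const measurable_const

/-- The hinge loss of the prediction `t` for the label `y`. -/
def hinge (y t : ℝ) : ℝ := max (1 - y * t) 0

lemma hinge_nonneg (y t : ℝ) : 0 ≤ hinge y t := le_max_right _ _

lemma abs_hinge_sub_hinge_le (y : SVMLabel) (s t : ℝ) :
    |hinge y s - hinge y t| ≤ |s - t| := by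
  refine (abs_max_sub_max_le_abs _ _ _).trans_eq ?_
  rw [show 1 - (y : ℝ) * s - (1 - y * t) = y * (t - s) by ring, abs_mul, abs_label, one_mul,
    abs_sub_comm]

lemma hinge_le (y : SVMLabel) (t : ℝ) : hinge y t ≤ 1 + |t| := by
  have := abs_mul (y : ℝ) t
  rw [abs_label, one_mul] at this
  exact max_le (by have := neg_abs_le ((y : ℝ) * t); linarith) (by positivity)

/-! ### Bayes classifier and comparison of risk with hinge risk. -/

section Risk

variable {X : Type*} [MeasurableSpace X]

/-- The expected hinge loss of `g`. -/
def hingeRisk (P : Measure (X × SVMLabel)) (g : X → ℝ) : ℝ := ∫ z, hinge z.2 (g z.1) ∂P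

lemma measurable_hinge_comp {g : X → ℝ} (hg : Measurable g) :
    Measurable fun z : X × SVMLabel => hinge z.2 (g z.1) := by
  unfold hinge; fun_prop

lemma integrable_hinge_comp (P : Measure (X × SVMLabel)) [IsFiniteMeasure P] {g : X → ℝ}
    (hg : Measurable g) {B : ℝ} (hB : ∀ x, |g x| ≤ B) :
    Integrable (fun z : X × SVMLabel => hinge z.2 (g z.1)) P := by
  refine Integrable.of_bound (measurable_hinge_comp hg).aestronglyMeasurable (1 + B) ?_
  refine ae_of_all _ fun z => ?_
  rw [Real.norm_of_nonneg (hinge_nonneg _ _)]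
  exact (hinge_le _ _).trans (by linarith [hB z.1])

lemma measurableSet_error {g : X → ℝ} (hg : Measurable g) :
    MeasurableSet {z : X × SVMLabel | labelSign (g z.1) ≠ (z.2 : ℝ)} := by
  have h1 : Measurable fun z : X × SVMLabel => labelSign (g z.1) :=
    measurable_labelSign.comp (hg.comp measurable_fst)
  have h2 : Measurable fun z : X × SVMLabel => (z.2 : ℝ) := by fun_prop
  exact (measurableSet_eq_fun h1 h2).compl

/-- The expectation of a bounded function of a labelled sample is the expectation, over the
sample, of a weighted sum over the two labels. -/
lemma exists_label_densities (P : Measure (X × SVMLabel)) [IsProbabilityMeasure P] :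
    ∃ h₁ h₂ : X → ℝ, Measurable h₁ ∧ Measurable h₂ ∧ (∀ x, 0 ≤ h₁ x) ∧ (∀ x, 0 ≤ h₂ x) ∧
      ∀ F : X × SVMLabel → ℝ, Measurable F → (∃ B, ∀ z, |F z| ≤ B) →
        Integrable (fun x => h₁ x * F (x, posLabel) + h₂ x * F (x, negLabel)) (P.map Prod.fst) ∧
        ∫ z, F z ∂P =
          ∫ x, (h₁ x * F (x, posLabel) + h₂ x * F (x, negLabel)) ∂(P.map Prod.fst) := by
  set μ : Measure X := P.map Prod.fst
  have : IsProbabilityMeasure μ := Measure.isProbabilityMeasure_map measurable_fst.aemeasurable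
  have key : ∀ y : SVMLabel, ∃ h : X → ℝ, Measurable h ∧ (∀ x, 0 ≤ h x) ∧
      ∀ F : X × SVMLabel → ℝ, Measurable F → (∃ B, ∀ z, |F z| ≤ B) →
        Integrable (fun x => h x * F (x, y)) μ ∧
        ∫ z in {z : X × SVMLabel | z.2 = y}, F z ∂P = ∫ x, h x * F (x, y) ∂μ := by
    intro y
    have hS : MeasurableSet {z : X × SVMLabel | z.2 = y} :=
      measurable_snd (measurableSet_singleton y)
    -- The part of `P` with label `y`, projected to `X`, is dominated by the marginal; its
    -- Radon–Nikodym derivative is the density, so no conditional distributions are needed.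
    set ν : Measure X := (P.restrict {z : X × SVMLabel | z.2 = y}).map Prod.fst
    have hac : ν ≪ μ := (Measure.restrict_le_self).absolutelyContinuous.map measurable_fst
    refine ⟨fun x => (ν.rnDeriv μ x).toReal, (Measure.measurable_rnDeriv _ _).ennreal_toReal,
      fun x => ENNReal.toReal_nonneg, fun F hF ⟨B, hB⟩ => ⟨?_, ?_⟩⟩
    · refine (Measure.integrable_toReal_rnDeriv (μ := ν) (ν := μ)).mul_bdd (c := B) ?_ ?_
      · exact (hF.comp (by fun_prop : Measurable fun x : X => (x, y))).aestronglyMeasurable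
      · exact ae_of_all _ fun x => hB _
    · have h1 : ∫ z in {z : X × SVMLabel | z.2 = y}, F z ∂P
          = ∫ z in {z : X × SVMLabel | z.2 = y}, F (z.1, y) ∂P := by
        refine setIntegral_congr_fun hS fun z hz => ?_
        have : z = (z.1, y) := Prod.ext rfl hz
        exact congrArg F this
      rw [h1]
      have hFy : Measurable fun x => F (x, y) := hF.comp (by fun_prop)
      rw [← integral_map (f := fun x => F (x, y)) measurable_fst.aemeasurable
        hFy.aestronglyMeasurable]
      exact (integral_rnDeriv_smul hac).symm
  obtain ⟨h₁, hm1, hn1, H1⟩ := key posLabel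
  obtain ⟨h₂, hm2, hn2, H2⟩ := key negLabel
  refine ⟨h₁, h₂, hm1, hm2, hn1, hn2, fun F hF hb => ?_⟩
  obtain ⟨I1, E1⟩ := H1 F hF hb
  obtain ⟨I2, E2⟩ := H2 F hF hb
  refine ⟨I1.add I2, ?_⟩
  rw [integral_add I1 I2, ← E1, ← E2]
  have hS : MeasurableSet {z : X × SVMLabel | z.2 = posLabel} :=
    measurable_snd (measurableSet_singleton _)
  have hc : {z : X × SVMLabel | z.2 = negLabel} = {z : X × SVMLabel | z.2 = posLabel}ᶜ := by
    ext z
    have hne : negLabel ≠ posLabel := fun h => by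
      have := congrArg Subtype.val h
      simp at this
      norm_num at this
    rcases label_eq z.2 with h | h
    · simp [h, hne.symm]
    · simp [h, hne]
  have hFi : Integrable F P := by
    obtain ⟨B, hB⟩ := hb
    exact Integrable.of_bound hF.aestronglyMeasurable B (ae_of_all _ hB)
  rw [hc, integral_add_compl hS hFi]

/-- The Bayes classifier minimizes the risk, and the excess risk of a bounded function is at most
its excess hinge risk over the Bayes classifier. -/
lemma exists_bayes_classifier (P : Measure (X × SVMLabel)) [IsProbabilityMeasure P] :
    ∃ g₀ : X → ℝ, Measurable g₀ ∧ (∀ x, |g₀ x| ≤ 1) ∧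
      (∀ g, Measurable g → risk P g₀ ≤ risk P g) ∧
      ∀ g, Measurable g → (∃ B, ∀ x, |g x| ≤ B) →
        (risk P g).toReal + hingeRisk P g₀ ≤ (risk P g₀).toReal + hingeRisk P g := by
  obtain ⟨h₁, h₂, hm1, hm2, hn1, hn2, H⟩ := exists_label_densities P
  set μ : Measure X := P.map Prod.fst
  set g₀ : X → ℝ := fun x => if h₂ x ≤ h₁ x then 1 else -1 with hg₀
  have hg₀m : Measurable g₀ :=
    Measurable.ite (measurableSet_le hm2 hm1) measurable_const measurable_const
  have hg₀b : ∀ x, |g₀ x| ≤ 1 := fun x => by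
    simp only [hg₀]; split_ifs <;> simp
  let E : (X → ℝ) → X × SVMLabel → ℝ := fun g =>
    Set.indicator {z : X × SVMLabel | labelSign (g z.1) ≠ (z.2 : ℝ)} 1
  have hEm : ∀ g, Measurable g → Measurable (E g) := fun g hg =>
    measurable_one.indicator (measurableSet_error hg)
  have hEb : ∀ g, ∃ B, ∀ z, |E g z| ≤ B := fun g => ⟨1, fun z => by
    by_cases hz : z ∈ {z : X × SVMLabel | labelSign (g z.1) ≠ (z.2 : ℝ)} <;>
      simp [E, hz]⟩
  have hR : ∀ g, Measurable g → (risk P g).toReal = ∫ z, E g z ∂P := fun g hg =>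
    (integral_indicator_one (measurableSet_error hg)).symm
  have hEpos : ∀ g x, E g (x, posLabel) = if 0 ≤ g x then 0 else 1 := fun g x => by
    by_cases h : 0 ≤ g x
    · simp [E, labelSign, h]
    · have : (-1 : ℝ) ≠ 1 := by norm_num
      simp [E, labelSign, h, this]
  have hEneg : ∀ g x, E g (x, negLabel) = if 0 ≤ g x then 1 else 0 := fun g x => by
    by_cases h : 0 ≤ g x
    · have : (1 : ℝ) ≠ -1 := by norm_num
      simp [E, labelSign, h, this]
    · simp [E, labelSign, h]
  refine ⟨g₀, hg₀m, hg₀b, fun g hg => ?_, fun g hg hb => ?_⟩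
  · refine (ENNReal.toReal_le_toReal (measure_ne_top _ _) (measure_ne_top _ _)).1 ?_
    change (risk P g₀).toReal ≤ (risk P g).toReal
    rw [hR _ hg₀m, hR _ hg, (H _ (hEm _ hg₀m) (hEb _)).2, (H _ (hEm _ hg) (hEb _)).2]
    refine integral_mono (H _ (hEm _ hg₀m) (hEb _)).1 (H _ (hEm _ hg) (hEb _)).1 fun x => ?_
    have h1 := hn1 x
    have h2 := hn2 x
    simp only [hEpos, hEneg, hg₀]
    split_ifs <;> simp at * <;> linarith
  · have hLb : ∀ f : X → ℝ, (∃ B, ∀ x, |f x| ≤ B) →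
        ∃ B, ∀ z : X × SVMLabel, |hinge z.2 (f z.1)| ≤ B := fun f ⟨B, hB⟩ => ⟨1 + B, fun z => by
      rw [abs_of_nonneg (hinge_nonneg _ _)]
      exact (hinge_le _ _).trans (by linarith [hB z.1])⟩
    have hEg := H _ (hEm _ hg) (hEb g)
    have hE0 := H _ (hEm _ hg₀m) (hEb g₀)
    have hLg := H _ (measurable_hinge_comp hg) (hLb g hb)
    have hL0 := H _ (measurable_hinge_comp hg₀m) (hLb g₀ ⟨1, hg₀b⟩)
    rw [hR _ hg₀m, hR _ hg]
    unfold hingeRisk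
    rw [hEg.2, hE0.2, hLg.2, hL0.2, ← integral_add hEg.1 hL0.1, ← integral_add hE0.1 hLg.1]
    -- The inequality holds pointwise. If `g` and `g₀` agree in sign, the error excess is zero and
    -- `g₀` minimizes the weighted hinge loss. Otherwise the error excess is `|h₁ - h₂|`, while `h₁
    -- (1 - g) + h₂ (1 + g) ≥ h₁ + h₂` exceeds the loss `2 min h₁ h₂` of `g₀` by at least as much.
    refine integral_mono (hEg.1.add hL0.1) (hE0.1.add hLg.1) fun x => ?_
    have h1 := hn1 x
    have h2 := hn2 x
    have a1 : 1 - g x ≤ hinge 1 (g x) := by unfold hinge; simp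
    have a2 : 1 + g x ≤ hinge (-1) (g x) := by unfold hinge; simp
    have a3 := hinge_nonneg 1 (g x)
    have a4 := hinge_nonneg (-1) (g x)
    have e1 : hinge 1 1 = 0 := by simp [hinge]
    have e2 : hinge 1 (-1) = 2 := by norm_num [hinge]
    have e3 : hinge (-1) 1 = 2 := by norm_num [hinge]
    have e4 : hinge (-1) (-1) = 0 := by norm_num [hinge]
    simp only [hEpos, hEneg, hg₀, coe_posLabel, coe_negLabel]
    have b1 := mul_le_mul_of_nonneg_left a1 h1
    have b2 := mul_le_mul_of_nonneg_left a2 h2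
    have b3 := mul_nonneg h1 a3
    have b4 := mul_nonneg h2 a4
    have n1 : ¬ (0 : ℝ) ≤ -1 := by norm_num
    by_cases h : h₂ x ≤ h₁ x <;> by_cases hx : 0 ≤ g x <;>
      simp only [h, hx, n1, e1, e2, e3, e4, if_true, if_false, zero_le_one] <;>
      first | rw [not_le] at h | skip
    all_goals first | rw [not_le] at hx | skip
    all_goals nlinarith
end Risk

/-! ### Uniform laws of large numbers through finite partitions. -/

section LargeNumbers

variable {Z : Type*} [MeasurableSpace Z]

/-- The frequency of the event `C` among the first `m` terms of `z`. -/
def freq (C : Set Z) (m : ℕ) (z : ℕ → Z) : ℝ :=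
  (1 / (m : ℝ)) * ∑ i : Fin m, C.indicator (1 : Z → ℝ) (z i)

/-- Hoeffding: the centred indicators are independent and sub-Gaussian with parameter `1/4`; the
factor `2` accounts for the two tails. -/
lemma measureReal_freq_dev_le (P : Measure Z) [IsProbabilityMeasure P] {C : Set Z}
    (hC : MeasurableSet C) {m : ℕ} (hm : 0 < m) {t : ℝ} (ht : 0 ≤ t) :
    (Measure.infinitePi fun _ : ℕ => P).real {z | t ≤ |freq C m z - P.real C|} ≤
      2 * Real.exp (-(2 * m * t ^ 2)) := by
  set μ := Measure.infinitePi fun _ : ℕ => P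
  have hm' : (0 : ℝ) < m := by exact_mod_cast hm
  let Y : Z → ℝ := fun x => C.indicator (1 : Z → ℝ) x - P.real C
  have hYm : Measurable Y := (measurable_one.indicator hC).sub_const _
  let V : ℕ → (ℕ → Z) → ℝ := fun i ω => Y (ω i)
  have hind : ProbabilityTheory.iIndepFun V μ :=
    ProbabilityTheory.iIndepFun_infinitePi (X := fun _ => Y) fun _ => hYm
  have hsub : ∀ i, ProbabilityTheory.HasSubgaussianMGF (V i) ((‖(1 : ℝ) - 0‖₊ / 2) ^ 2) μ := by
    intro i
    have hU : Measurable fun ω : ℕ → Z => C.indicator (1 : Z → ℝ) (ω i) :=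
      (measurable_one.indicator hC).comp (measurable_pi_apply i)
    have := ProbabilityTheory.hasSubgaussianMGF_of_mem_Icc (μ := μ) (a := 0) (b := 1)
      hU.aemeasurable (ae_of_all _ fun ω => by
        by_cases h : ω i ∈ C <;> simp [h])
    have e : ∫ ω, C.indicator (1 : Z → ℝ) (ω i) ∂μ = P.real C := by
      have hp := measurePreserving_eval_infinitePi (fun _ : ℕ => P) i
      rw [← integral_indicator_one hC, ← hp.map_eq,
        integral_map hp.measurable.aemeasurable
          (measurable_one.indicator hC).aestronglyMeasurable]
    rw [e] at this
    exact this
  have hnn : ∀ i, ProbabilityTheory.HasSubgaussianMGF (-V i) ((‖(1 : ℝ) - 0‖₊ / 2) ^ 2) μ :=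
    fun i => (hsub i).neg
  have hind' : ProbabilityTheory.iIndepFun (fun i => -V i) μ :=
    hind.comp (fun _ x => -x) fun _ => measurable_neg
  have hmt : 0 ≤ m * t := by positivity
  have b1 := ProbabilityTheory.HasSubgaussianMGF.measure_sum_range_ge_le_of_iIndepFun
    hind (n := m) (fun i _ => hsub i) hmt
  have b2 := ProbabilityTheory.HasSubgaussianMGF.measure_sum_range_ge_le_of_iIndepFun
    hind' (n := m) (fun i _ => hnn i) hmt
  have ee : -(m * t) ^ 2 / (2 * m * (((‖(1 : ℝ) - 0‖₊ / 2) ^ 2 : ℝ≥0) : ℝ))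
      = -(2 * m * t ^ 2) := by
    simp
    field_simp
  rw [ee] at b1 b2
  have hsum : ∀ z : ℕ → Z, ∑ i ∈ Finset.range m, V i z = m * (freq C m z - P.real C) := by
    intro z
    simp only [V, Y, freq]
    rw [Finset.sum_sub_distrib, Finset.sum_const, Finset.card_range, nsmul_eq_mul,
      Finset.sum_range]
    field_simp
  have hss : {z | t ≤ |freq C m z - P.real C|} ⊆
      {z | m * t ≤ ∑ i ∈ Finset.range m, V i z} ∪
        {z | m * t ≤ ∑ i ∈ Finset.range m, (-V i) z} := by
    intro z hz
    rcases le_abs.1 (show t ≤ |freq C m z - P.real C| from hz) with h | h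
    · left
      change m * t ≤ ∑ i ∈ Finset.range m, V i z
      rw [hsum]
      exact mul_le_mul_of_nonneg_left h hm'.le
    · right
      change m * t ≤ ∑ i ∈ Finset.range m, -(V i z)
      rw [Finset.sum_neg_distrib, hsum, ← mul_neg]
      exact mul_le_mul_of_nonneg_left h hm'.le
  calc μ.real {z | t ≤ |freq C m z - P.real C|} ≤ _ := measureReal_mono hss
    _ ≤ _ := measureReal_union_le _ _
    _ ≤ _ := add_le_add b1 b2
    _ = _ := by ring

/-- Almost surely, the frequencies of at most `m` events deviate eventually from their
probabilities by less than `m ^ (-1/4)`. -/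
lemma ae_eventually_freq_dev_lt (P : Measure Z) [IsProbabilityMeasure P]
    (q : ℕ → SimpleFunc Z Z) (hq : ∀ᶠ m in atTop, (q m).range.card ≤ m) :
    ∀ᵐ z ∂(Measure.infinitePi fun _ : ℕ => P), ∀ᶠ m : ℕ in atTop, ∀ v ∈ (q m).range,
      |freq (q m ⁻¹' {v}) m z - P.real (q m ⁻¹' {v})| < (√√(m : ℝ))⁻¹ := by
  set μ := Measure.infinitePi fun _ : ℕ => P
  let bad : ℕ → Set (ℕ → Z) := fun m => ⋃ v ∈ (q m).range,
    {z | (√√(m : ℝ))⁻¹ ≤ |freq (q m ⁻¹' {v}) m z - P.real (q m ⁻¹' {v})|}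
  have hbound : ∀ᶠ m : ℕ in atTop, μ.real (bad m) ≤ 1440 * (1 / (m : ℝ) ^ 2) := by
    filter_upwards [hq, eventually_gt_atTop 0] with m hm h0
    have h0' : (0 : ℝ) < m := by exact_mod_cast h0
    -- For `t = m ^ (-1/4)` one has `m t² = √m`, and the sixth-order term of the series of `exp √m`
    -- is `m³ / 720`. The power three leaves a summable `1 / m²` after a union bound over at most
    -- `m` cells.
    have hexp : Real.exp (-(2 * m * ((√√(m : ℝ))⁻¹) ^ 2)) ≤ 720 / (m : ℝ) ^ 3 := by
      have e1 : (m : ℝ) * ((√√(m : ℝ))⁻¹) ^ 2 = √(m : ℝ) := by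
        rw [inv_pow, Real.sq_sqrt (Real.sqrt_nonneg _)]
        rw [← div_eq_mul_inv, Real.div_sqrt]
      have e2 : (√(m : ℝ)) ^ 6 = (m : ℝ) ^ 3 := by
        rw [show 6 = 2 * 3 from rfl, pow_mul, Real.sq_sqrt h0'.le]
      have e3 := Real.pow_div_factorial_le_exp (√(m : ℝ)) (Real.sqrt_nonneg _) 6
      rw [e2] at e3
      have e4 : (Nat.factorial 6 : ℝ) = 720 := by norm_num [Nat.factorial]
      rw [e4] at e3
      calc Real.exp (-(2 * m * ((√√(m : ℝ))⁻¹) ^ 2))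
          ≤ Real.exp (-√(m : ℝ)) := by
            apply Real.exp_le_exp.2
            rw [mul_assoc, e1]
            linarith [Real.sqrt_nonneg (m : ℝ)]
        _ = (Real.exp (√(m : ℝ)))⁻¹ := Real.exp_neg _
        _ ≤ ((m : ℝ) ^ 3 / 720)⁻¹ := inv_anti₀ (by positivity) e3
        _ = _ := by rw [inv_div]
    calc μ.real (bad m)
        ≤ ∑ v ∈ (q m).range,
          μ.real {z | (√√(m : ℝ))⁻¹ ≤ |freq (q m ⁻¹' {v}) m z - P.real (q m ⁻¹' {v})|} :=
          measureReal_biUnion_finset_le _ _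
      _ ≤ ∑ v ∈ (q m).range, 2 * (720 / (m : ℝ) ^ 3) := by
          refine Finset.sum_le_sum fun v _ => ?_
          refine (measureReal_freq_dev_le P ((q m).measurableSet_fiber v) h0
            (by positivity)).trans ?_
          linarith
      _ = (q m).range.card * (2 * (720 / (m : ℝ) ^ 3)) := by
          rw [Finset.sum_const, nsmul_eq_mul]
      _ ≤ m * (2 * (720 / (m : ℝ) ^ 3)) := by
          have : ((q m).range.card : ℝ) ≤ m := by exact_mod_cast hm
          gcongr
      _ = _ := by field_simp; norm_num
  have hsum : Summable fun m => μ.real (bad m) := by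
    refine Summable.of_norm_bounded_eventually_nat
      ((Real.summable_one_div_nat_pow.2 one_lt_two).mul_left 1440) ?_
    filter_upwards [hbound] with m hm
    rwa [Real.norm_of_nonneg measureReal_nonneg]
  have hfin : ∑' m, μ (bad m) ≠ ∞ := by
    have := hsum.tsum_ofReal_ne_top
    simpa [ofReal_measureReal] using this
  filter_upwards [ae_eventually_notMem hfin] with z hz
  filter_upwards [hz] with m hm v hv
  by_contra hlt
  exact hm (Set.mem_biUnion hv (not_lt.1 hlt))

/-- A function that is nearly constant on each cell of a finite partition has an empirical mean
close to its expectation if the frequencies of all cells are close to their probabilities. -/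
lemma abs_mean_sub_integral_le (P : Measure Z) [IsProbabilityMeasure P] (q : SimpleFunc Z Z)
    {h : Z → ℝ} (hh : Measurable h) {η B t : ℝ} (hη : ∀ z, |h z - h (q z)| ≤ η)
    (hB : ∀ z, |h z| ≤ B) {m : ℕ} (hm : 0 < m) (z : ℕ → Z)
    (ht : ∀ v ∈ q.range, |freq (q ⁻¹' {v}) m z - P.real (q ⁻¹' {v})| ≤ t) :
    |(1 / (m : ℝ)) * ∑ i : Fin m, h (z i) - ∫ x, h x ∂P| ≤ 2 * η + q.range.card * (B * t) := by
  have hm' : (0 : ℝ) < m := by exact_mod_cast hm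
  have hrep : ∀ x, h (q x) = ∑ v ∈ q.range, h v * (q ⁻¹' {v}).indicator (1 : Z → ℝ) x := by
    intro x
    rw [Finset.sum_eq_single_of_mem (q x) (q.mem_range_self x)]
    · simp
    · intro v _ hv
      have : x ∉ q ⁻¹' {v} := fun hx => hv (by simpa using hx.symm)
      simp [this]
  have hmq : Measurable fun x => h (q x) := hh.comp q.measurable
  have i1 : Integrable h P := Integrable.of_bound hh.aestronglyMeasurable B (ae_of_all _ hB)
  have i2 : Integrable (fun x => h (q x)) P :=
    Integrable.of_bound hmq.aestronglyMeasurable B (ae_of_all _ fun x => hB _)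
  have hint : ∫ x, h (q x) ∂P = ∑ v ∈ q.range, h v * P.real (q ⁻¹' {v}) := by
    simp_rw [hrep]
    rw [integral_finsetSum]
    · refine Finset.sum_congr rfl fun v _ => ?_
      rw [integral_const_mul, integral_indicator_one (q.measurableSet_fiber v)]
    · intro v _
      exact ((integrable_const (1 : ℝ)).indicator (q.measurableSet_fiber v)).const_mul _
  have hemp : (1 / (m : ℝ)) * ∑ i : Fin m, h (q (z i)) =
      ∑ v ∈ q.range, h v * freq (q ⁻¹' {v}) m z := by
    simp_rw [hrep, freq]
    rw [Finset.sum_comm, Finset.mul_sum]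
    refine Finset.sum_congr rfl fun v _ => ?_
    rw [← Finset.mul_sum]
    ring
  -- Replacing `h` by `h ∘ q` costs `η` in the empirical mean and `η` in the integral; for `h ∘ q`
  -- both are finite sums over the cells.
  have d1 : |(1 / (m : ℝ)) * ∑ i : Fin m, h (z i) - (1 / (m : ℝ)) * ∑ i : Fin m, h (q (z i))|
      ≤ η := by
    rw [← mul_sub, ← Finset.sum_sub_distrib, abs_mul, abs_of_nonneg (by positivity)]
    calc (1 / (m : ℝ)) * |∑ i : Fin m, (h (z i) - h (q (z i)))|
        ≤ (1 / (m : ℝ)) * ∑ i : Fin m, η := by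
          gcongr
          exact (Finset.abs_sum_le_sum_abs _ _).trans (Finset.sum_le_sum fun i _ => hη _)
      _ = η := by simp; field_simp
  have d2 : |∫ x, h (q x) ∂P - ∫ x, h x ∂P| ≤ η := by
    rw [← integral_sub i2 i1]
    have := norm_integral_le_of_norm_le_const (μ := P) (C := η)
      (f := fun x => h (q x) - h x) (ae_of_all _ fun x => by
        rw [Real.norm_eq_abs, abs_sub_comm]
        exact hη x)
    simpa using this
  have d3 : |(1 / (m : ℝ)) * ∑ i : Fin m, h (q (z i)) - ∫ x, h (q x) ∂P|
      ≤ q.range.card * (B * t) := by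
    rw [hemp, hint, ← Finset.sum_sub_distrib, ← nsmul_eq_mul]
    refine (Finset.abs_sum_le_sum_abs _ _).trans (Finset.sum_le_card_nsmul _ _ _ fun v hv => ?_)
    rw [← mul_sub, abs_mul]
    exact mul_le_mul (hB v) (ht v hv) (abs_nonneg _) ((abs_nonneg _).trans (hB v))
  have t1 := abs_sub_le ((1 / (m : ℝ)) * ∑ i : Fin m, h (z i))
    ((1 / (m : ℝ)) * ∑ i : Fin m, h (q (z i))) (∫ x, h x ∂P)
  have t2 := abs_sub_le ((1 / (m : ℝ)) * ∑ i : Fin m, h (q (z i))) (∫ x, h (q x) ∂P) (∫ x, h x ∂P)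
  linarith

end LargeNumbers

/-! ### Smooth kernels: uniform continuity and quantization of the features. -/

section FeatureMap

variable {H : Type*} [NormedAddCommGroup H] [InnerProductSpace ℝ H]

/-- The left side of the smoothness condition is `‖Φ x - Φ x'‖²`, and `f` is continuous at `0` with
`f 0 = 0`. -/
lemma IsSmoothKernel.uniformContinuous {E : Type*} [SeminormedAddCommGroup E] {X : Set E}
    {Φ : X → H} (h : IsSmoothKernel X (featureKernel Φ)) : UniformContinuous Φ := by
  obtain ⟨ρ, f, hρ, hf, hmono, hf0, hk⟩ := h
  rw [Metric.uniformContinuous_iff]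
  intro ε hε
  have hlim : Tendsto (fun r : ℝ≥0 => (f (r ^ 2) : ℝ)) (𝓝 0) (𝓝 0) := by
    have : Continuous fun r : ℝ≥0 => (f (r ^ 2) : ℝ) := by fun_prop
    simpa [hf0] using this.tendsto 0
  have hev := hlim.eventually (gt_mem_nhds (show 0 < ε ^ 2 by positivity))
  obtain ⟨d, hd, hdd⟩ := Metric.eventually_nhds_iff.1 hev
  refine ⟨min ρ d, lt_min hρ hd, fun {x x'} hxx => ?_⟩
  have hn : dist x x' = ‖(x : E) - x'‖ := by rw [Subtype.dist_eq, dist_eq_norm]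
  have h1 : ‖(x : E) - x'‖ ≤ ρ := by rw [← hn]; exact hxx.le.trans (min_le_left _ _)
  have h2 : (f (‖(x : E) - x'‖₊ ^ 2) : ℝ) < ε ^ 2 := by
    refine hdd ?_
    rw [NNReal.dist_eq]
    simp only [coe_nnnorm, NNReal.coe_zero, sub_zero, abs_norm]
    rw [← hn]
    exact hxx.trans_le (min_le_right _ _)
  have h3 := (hk x x' h1).trans_lt h2
  have h4 : ‖Φ x - Φ x'‖ ^ 2 < ε ^ 2 := by
    rw [norm_sub_sq_real, ← real_inner_self_eq_norm_sq, ← real_inner_self_eq_norm_sq]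
    unfold featureKernel at h3
    linarith
  rw [dist_eq_norm]
  exact lt_of_pow_lt_pow_left₀ 2 hε.le h4

end FeatureMap

section TotallyBounded

variable {H : Type*} [NormedAddCommGroup H]

/-- Labelled samples can be replaced by finitely many ones with the same labels and nearby
features. -/
lemma exists_quantizer {X : Type*} [PseudoMetricSpace X] [MeasurableSpace X]
    [OpensMeasurableSpace X] (hX : TotallyBounded (Set.univ : Set X)) {Φ : X → H}
    (hΦ : UniformContinuous Φ) {δ : ℝ} (hδ : 0 < δ) :
    ∃ q : SimpleFunc (X × SVMLabel) (X × SVMLabel),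
      ∀ z, (q z).2 = z.2 ∧ ‖Φ z.1 - Φ (q z).1‖ ≤ δ := by
  rcases isEmpty_or_nonempty X with hemp | ⟨⟨x₀⟩⟩
  · exact ⟨SimpleFunc.ofIsEmpty, fun z => isEmptyElim z.1⟩
  obtain ⟨d, hd, hdd⟩ := Metric.uniformContinuous_iff.1 hΦ δ hδ
  obtain ⟨s, hs, hcov⟩ := Metric.totallyBounded_iff.1 hX d hd
  -- Inserting `x₀` makes the finite net nonempty, so that a sequence can list it. `nearestPt e N`
  -- sees only `e 0, …, e N`, hence the `N` below that exhausts the net.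
  obtain ⟨e, he⟩ := (hs.insert x₀).countable.exists_eq_range (Set.insert_nonempty _ _)
  have hidx : ∃ N, ∀ y ∈ s, ∃ k ≤ N, e k = y := by
    have : ∀ y ∈ s, ∃ k, e k = y := fun y hy => by
      have : y ∈ Set.range e := he ▸ Set.mem_insert_of_mem _ hy
      exact this
    choose! k hk using this
    obtain ⟨N, hN⟩ := (hs.image k).bddAbove
    exact ⟨N, fun y hy => ⟨k y, hN (Set.mem_image_of_mem _ hy), hk y hy⟩⟩
  obtain ⟨N, hN⟩ := hidx
  refine ⟨((SimpleFunc.nearestPt e N).comp Prod.fst measurable_fst).pair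
    ((SimpleFunc.ofFinite (id : SVMLabel → SVMLabel)).comp Prod.snd measurable_snd),
    fun z => ⟨rfl, ?_⟩⟩
  change ‖Φ z.1 - Φ (SimpleFunc.nearestPt e N z.1)‖ ≤ δ
  rw [← dist_eq_norm]
  obtain ⟨y, hy, hzy⟩ := Set.mem_iUnion₂.1 (hcov (Set.mem_univ z.1))
  obtain ⟨k, hk, rfl⟩ := hN y hy
  have h1 := SimpleFunc.edist_nearestPt_le e z.1 hk
  rw [edist_dist, edist_dist, ENNReal.ofReal_le_ofReal_iff dist_nonneg] at h1
  rw [dist_comm] at h1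
  rw [Metric.mem_ball, dist_comm] at hzy
  exact (hdd (h1.trans_lt hzy)).le

lemma exists_norm_feature_le {X : Type*} [PseudoMetricSpace X]
    (hX : TotallyBounded (Set.univ : Set X)) {Φ : X → H} (hΦ : UniformContinuous Φ) :
    ∃ κ, 0 ≤ κ ∧ ∀ x, ‖Φ x‖ ≤ κ := by
  obtain ⟨C, hC⟩ := (hX.image hΦ).isBounded.exists_norm_le
  exact ⟨max C 0, le_max_right _ _, fun x =>
    (hC _ (Set.mem_image_of_mem _ (Set.mem_univ x))).trans (le_max_left _ _)⟩

end TotallyBounded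

/-! ### Clipping the bias. -/

/-- The projection of `b` to the interval `[-r, r]`. -/
def clip (r b : ℝ) : ℝ := max (-r) (min b r)

lemma abs_clip_le {r : ℝ} (hr : 0 ≤ r) (b : ℝ) : |clip r b| ≤ r :=
  abs_le.2 ⟨le_max_left _ _, max_le (by linarith) (min_le_right _ _)⟩

lemma clip_cases {r : ℝ} (hr : 0 ≤ r) (b : ℝ) :
    clip r b = b ∨ (r < b ∧ clip r b = r) ∨ (b < -r ∧ clip r b = -r) := by
  unfold clip
  rcases lt_or_ge r b with h | h
  · right; left
    exact ⟨h, by rw [min_eq_right h.le, max_eq_right (by linarith)]⟩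
  · rw [min_eq_left h]
    rcases lt_or_ge b (-r) with h' | h'
    · right; right
      exact ⟨h', max_eq_left h'.le⟩
    · left
      exact max_eq_right h'

/-- Beyond `|s| + 1` the bias alone decides the sign, before and after clipping. -/
lemma labelSign_add_clip {s r : ℝ} (hs : |s| + 1 ≤ r) (b : ℝ) :
    labelSign (s + clip r b) = labelSign (s + b) := by
  obtain ⟨h1, h2⟩ := abs_le.1 (le_refl |s|)
  have hr : 0 ≤ r := by linarith [abs_nonneg s]
  rcases clip_cases hr b with h | ⟨h, h'⟩ | ⟨h, h'⟩
  · rw [h]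
  · rw [h', labelSign, labelSign, if_pos (by linarith), if_pos (by linarith)]
  · rw [h', labelSign, labelSign, if_neg (by linarith), if_neg (by linarith)]

/-- When clipping acts, the clipped prediction still has margin at least `1`: the label of its sign
has loss zero, and the loss for the other label drops as the bias moves towards `0`. -/
lemma hinge_add_clip_le (y : SVMLabel) {s r : ℝ} (hs : |s| + 1 ≤ r) (b : ℝ) :
    hinge y (s + clip r b) ≤ hinge y (s + b) := by
  obtain ⟨h1, h2⟩ := abs_le.1 (le_refl |s|)
  unfold hinge
  have hr : 0 ≤ r := by linarith [abs_nonneg s]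
  rcases clip_cases hr b with h | ⟨h, h'⟩ | ⟨h, h'⟩
  · rw [h]
  · rw [h']
    rcases label_eq y with rfl | rfl
    · exact max_le (by simp only [coe_posLabel]; exact le_max_of_le_right (by linarith))
        (le_max_right _ _)
    · exact max_le_max (by simp only [coe_negLabel]; linarith) le_rfl
  · rw [h']
    rcases label_eq y with rfl | rfl
    · exact max_le_max (by simp only [coe_posLabel]; linarith) le_rfl
    · exact max_le (by simp only [coe_negLabel]; exact le_max_of_le_right (by linarith))
        (le_max_right _ _)

/-! ### Existence and a priori bounds for SVM minimizers. -/

section SVM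

variable {X : Type*} {H : Type*} [NormedAddCommGroup H] [InnerProductSpace ℝ H]

lemma svmObjective_eq (Φ : X → H) (c : ℝ) {m : ℕ} (T : Fin m → X × SVMLabel) (p : H × ℝ) :
    svmObjective Φ c T p = c * ‖p.1‖ +
      (1 / (m : ℝ)) * ∑ i, hinge (T i).2 (inner ℝ p.1 (Φ (T i).1) + p.2) := rfl

lemma mul_norm_le_svmObjective (Φ : X → H) (c : ℝ) {m : ℕ} (T : Fin m → X × SVMLabel)
    (p : H × ℝ) : c * ‖p.1‖ ≤ svmObjective Φ c T p := by
  rw [svmObjective_eq]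
  have := Finset.sum_nonneg fun (i : Fin m) (_ : i ∈ Finset.univ) =>
    hinge_nonneg (T i).2 (inner ℝ p.1 (Φ (T i).1) + p.2)
  have : 0 ≤ (1 / (m : ℝ)) * ∑ i, hinge (T i).2 (inner ℝ p.1 (Φ (T i).1) + p.2) := by positivity
  linarith

/-- Each sample has loss `1` at the origin. Together with `mul_norm_le_svmObjective` this forces
`‖w‖ ≤ 1 / c` at a minimizer. -/
lemma svmObjective_zero_le (Φ : X → H) (c : ℝ) {m : ℕ} (T : Fin m → X × SVMLabel) :
    svmObjective Φ c T 0 ≤ 1 := by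
  rw [svmObjective_eq]
  simp only [Prod.fst_zero, Prod.snd_zero, norm_zero, inner_zero_left, hinge]
  rcases Nat.eq_zero_or_pos m with rfl | hm
  · simp
  · have : (0 : ℝ) < m := by exact_mod_cast hm
    simp
    field_simp
    exact le_rfl

lemma svmObjective_clip_le (Φ : X → H) {κ R : ℝ} (hκ : ∀ x, ‖Φ x‖ ≤ κ) (c : ℝ) {m : ℕ}
    (T : Fin m → X × SVMLabel) (w : H) (hw : ‖w‖ ≤ R) (b : ℝ) :
    svmObjective Φ c T (w, clip (1 + κ * R) b) ≤ svmObjective Φ c T (w, b) := by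
  rw [svmObjective_eq, svmObjective_eq]
  gcongr with i
  refine hinge_add_clip_le _ ?_ _
  have h1 := abs_real_inner_le_norm w (Φ (T i).1)
  have h2 : ‖w‖ * ‖Φ (T i).1‖ ≤ R * κ :=
    mul_le_mul hw (hκ _) (norm_nonneg _) ((norm_nonneg _).trans hw)
  change |inner ℝ w (Φ (T i).1)| + 1 ≤ _
  linarith

/-- The SVM objective has a minimizer. -/
lemma exists_svm_minimizer (Φ : X → H) {κ : ℝ} (hκ₀ : 0 ≤ κ) (hκ : ∀ x, ‖Φ x‖ ≤ κ) {c : ℝ}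
    (hc : 0 < c) {m : ℕ} (T : Fin m → X × SVMLabel) :
    ∃ p : H × ℝ, ∀ q, svmObjective Φ c T p ≤ svmObjective Φ c T q := by
  -- Representer argument: projecting `w` onto the span of the sample features keeps every
  -- prediction and does not increase the norm. With the bias clipped, the competition takes place
  -- in a compact set; outside radius `1 / c` the penalty alone exceeds the value at the origin.
  let K : Submodule ℝ H := Submodule.span ℝ (Set.range fun i => Φ (T i).1)
  have hfin : FiniteDimensional ℝ K := FiniteDimensional.span_of_finite ℝ (Set.finite_range _)
  have : ProperSpace K := FiniteDimensional.proper ℝ K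
  set r : ℝ := 1 + κ * (1 / c)
  have hr : 0 ≤ r := by positivity
  let G : K × ℝ → ℝ := fun p => svmObjective Φ c T (p.1, p.2)
  have hG : Continuous G := by
    simp only [G, svmObjective]
    fun_prop
  have hcomp : IsCompact (Metric.closedBall (0 : K) (1 / c) ×ˢ Set.Icc (-r) r) :=
    (isCompact_closedBall _ _).prod isCompact_Icc
  obtain ⟨p, -, hp⟩ := hcomp.exists_isMinOn
    ⟨(0, 0), ⟨Metric.mem_closedBall_self (by positivity), by constructor <;> linarith⟩⟩
    hG.continuousOn
  refine ⟨(p.1, p.2), fun q => ?_⟩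
  rcases le_or_gt ‖q.1‖ (1 / c) with hq | hq
  · let w : K := K.orthogonalProjectionOnto q.1
    have hw : ‖w‖ ≤ ‖q.1‖ := by
      refine (K.orthogonalProjectionOnto.le_opNorm q.1).trans ?_
      exact mul_le_of_le_one_left (norm_nonneg _) (Submodule.orthogonalProjectionOnto_norm_le K)
    have hin : ∀ i, inner ℝ (w : H) (Φ (T i).1) = inner ℝ q.1 (Φ (T i).1) := fun i => by
      have := K.starProjection_inner_eq_zero q.1 (Φ (T i).1)
        (Submodule.subset_span (Set.mem_range_self i))
      rw [inner_sub_left] at this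
      exact (sub_eq_zero.1 this).symm
    have hmem : (w, clip r q.2) ∈ Metric.closedBall (0 : K) (1 / c) ×ˢ Set.Icc (-r) r :=
      ⟨by simpa using hw.trans hq, abs_le.1 (abs_clip_le hr _)⟩
    refine (hp hmem).trans ((svmObjective_clip_le Φ hκ c T (w : H) (hw.trans hq) q.2).trans ?_)
    rw [svmObjective_eq, svmObjective_eq]
    simp only [hin]
    gcongr
    exact hw
  · have hmem : ((0 : K), (0 : ℝ)) ∈ Metric.closedBall (0 : K) (1 / c) ×ˢ Set.Icc (-r) r :=
      ⟨Metric.mem_closedBall_self (by positivity), by constructor <;> linarith⟩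
    calc svmObjective Φ c T (p.1, p.2) ≤ svmObjective Φ c T 0 := hp hmem
      _ ≤ 1 := svmObjective_zero_le Φ c T
      _ ≤ c * ‖q.1‖ := by
        rw [div_lt_iff₀ hc] at hq
        linarith
      _ ≤ _ := mul_norm_le_svmObjective Φ c T q

end SVM

/-- Take the largest `j ≤ m` with `N j ≤ m`; this is monotone in `m` even if `N` is not. For `m < N
0` the search may return its default `0`, so the bound holds only eventually. -/
lemma exists_slow_growth (N : ℕ → ℕ) :
    ∃ k : ℕ → ℕ, Monotone k ∧ Tendsto k atTop atTop ∧ ∀ᶠ m in atTop, N (k m) ≤ m := by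
  refine ⟨fun m => Nat.findGreatest (fun j => N j ≤ m) m, fun a b hab => ?_, ?_, ?_⟩
  · exact Nat.findGreatest_mono (fun j hj => hj.trans hab) hab
  · refine tendsto_atTop.2 fun K => ?_
    filter_upwards [eventually_ge_atTop (max K (N K))] with m hm
    exact Nat.le_findGreatest (le_of_max_le_left hm) (le_of_max_le_right hm)
  · filter_upwards [eventually_ge_atTop (N 0)] with m hm
    exact Nat.findGreatest_spec (P := fun j => N j ≤ m) (Nat.zero_le m) hm

/-! ### From uniform deviation bounds to consistency. -/

section Consistency

variable {X : Type*} {H : Type*} [NormedAddCommGroup H] [InnerProductSpace ℝ H]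

/-- The empirical mean of the hinge loss of `x ↦ ⟨w, Φ x⟩ + b` over the first `m` samples. -/
def empiricalHinge (Φ : X → H) (m : ℕ) (z : ℕ → X × SVMLabel) (p : H × ℝ) : ℝ :=
  (1 / (m : ℝ)) * ∑ i : Fin m, hinge (z i).2 (inner ℝ p.1 (Φ (z i).1) + p.2)

lemma svmObjective_eq_add_empiricalHinge (Φ : X → H) (c : ℝ) (m : ℕ) (z : ℕ → X × SVMLabel)
    (p : H × ℝ) :
    svmObjective Φ c (fun i : Fin m => z i) p = c * ‖p.1‖ + empiricalHinge Φ m z p := rfl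

lemma abs_inner_le_of_norm_le {Φ : X → H} {κ r : ℝ} (hκ : ∀ x, ‖Φ x‖ ≤ κ) {w : H}
    (hw : ‖w‖ ≤ r) (x : X) : |inner ℝ w (Φ x)| ≤ κ * r := by
  refine (abs_real_inner_le_norm w (Φ x)).trans ?_
  rw [mul_comm κ]
  exact mul_le_mul hw (hκ _) (norm_nonneg _) ((norm_nonneg _).trans hw)

/-- The loss is 1-Lipschitz in the prediction, so passing to the representative of a cell changes it
by at most `r δ`, and it is bounded by `2 + 2 κ r`. The estimate is uniform in `(w, b)` because the
sample enters only through cell frequencies. -/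
lemma abs_empiricalHinge_sub_hingeRisk_le [MeasurableSpace X] (P : Measure (X × SVMLabel))
    [IsProbabilityMeasure P] {Φ : X → H} (hΦ : ∀ w : H, Measurable fun x => inner ℝ w (Φ x))
    {κ : ℝ} (hκ : ∀ x, ‖Φ x‖ ≤ κ) (q : SimpleFunc (X × SVMLabel) (X × SVMLabel)) {δ : ℝ}
    (hq : ∀ z, (q z).2 = z.2 ∧ ‖Φ z.1 - Φ (q z).1‖ ≤ δ) {m : ℕ} (hm : 0 < m)
    (z : ℕ → X × SVMLabel) {t : ℝ}
    (ht : ∀ v ∈ q.range, |freq (q ⁻¹' {v}) m z - P.real (q ⁻¹' {v})| ≤ t)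
    {r : ℝ} {w : H} {b : ℝ} (hw : ‖w‖ ≤ r) (hb : |b| ≤ 1 + κ * r) :
    |empiricalHinge Φ m z (w, b) - hingeRisk P fun x => inner ℝ w (Φ x) + b| ≤
      2 * (r * δ) + q.range.card * ((2 + 2 * (κ * r)) * t) := by
  refine abs_mean_sub_integral_le P q
    (h := fun z => hinge z.2 (inner ℝ w (Φ z.1) + b))
    (measurable_hinge_comp ((hΦ w).add_const b)) (fun z => ?_) (fun z => ?_) hm z ht
  · obtain ⟨h1, h2⟩ := hq z
    rw [h1]
    refine (abs_hinge_sub_hinge_le _ _ _).trans ?_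
    rw [add_sub_add_right_eq_sub, ← inner_sub_right]
    refine (abs_real_inner_le_norm _ _).trans ?_
    exact mul_le_mul hw h2 (norm_nonneg _) ((norm_nonneg _).trans hw)
  · rw [abs_of_nonneg (hinge_nonneg _ _)]
    refine (hinge_le _ _).trans ?_
    have h1 := abs_add_le (inner ℝ w (Φ z.1)) b
    have h2 := abs_inner_le_of_norm_le hκ hw z.1
    linarith

/-- Universality lets linear functions in the feature space approximate the hinge risk of any
bounded measurable function. -/
lemma IsUniversal.exists_hingeRisk_le [TopologicalSpace X] [TopologicalSpace.PseudoMetrizableSpace X]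
    [MeasurableSpace X] [BorelSpace X] {Φ : X → H} (huniv : IsUniversal Φ)
    (P : Measure (X × SVMLabel)) [IsProbabilityMeasure P]
    (hΦ : ∀ w : H, Measurable fun x => inner ℝ w (Φ x)) {κ : ℝ} (hκ : ∀ x, ‖Φ x‖ ≤ κ)
    {g : X → ℝ} (hg : Measurable g) {B : ℝ} (hB : ∀ x, |g x| ≤ B) {ε : ℝ} (hε : 0 < ε) :
    ∃ w : H, hingeRisk P (fun x => inner ℝ w (Φ x) + 0) ≤ hingeRisk P g + ε := by
  set μ : Measure X := P.map Prod.fst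
  have : IsProbabilityMeasure μ := Measure.isProbabilityMeasure_map measurable_fst.aemeasurable
  have hgi : Integrable g μ := Integrable.of_bound hg.aestronglyMeasurable B (ae_of_all _ hB)
  -- Half of `ε` pays for the `L¹` approximation of `g` by a continuous `φ`, half for the uniform
  -- approximation of `φ`; the Lipschitz hinge loss transfers both.
  obtain ⟨φ, hφ, hφi⟩ := hgi.exists_boundedContinuous_integral_sub_le (half_pos hε)
  obtain ⟨w, hw⟩ := huniv φ.toContinuousMap (ε / 2) (half_pos hε)
  refine ⟨w, ?_⟩
  have hi1 := integrable_hinge_comp P ((hΦ w).add_const 0) (B := κ * ‖w‖) fun x => by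
    rw [add_zero]
    exact abs_inner_le_of_norm_le hκ le_rfl x
  have hi2 := integrable_hinge_comp P hg hB
  have hn : Integrable (fun x => ‖g x - φ x‖) μ := (hgi.sub hφi).norm
  have hd : Integrable (fun x => ‖g x - φ x‖ + ε / 2) μ :=
    hn.add (integrable_const _)
  have hd' : Integrable (fun z : X × SVMLabel => ‖g z.1 - φ z.1‖ + ε / 2) P :=
    hd.comp_measurable measurable_fst
  have hle : hingeRisk P (fun x => inner ℝ w (Φ x) + 0) ≤
      ∫ z, (hinge z.2 (g z.1) + (‖g z.1 - φ z.1‖ + ε / 2)) ∂P := by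
    refine integral_mono hi1 (hi2.add hd') fun z => ?_
    have h1 := (le_abs_self _).trans
      (abs_hinge_sub_hinge_le z.2 (inner ℝ w (Φ z.1) + 0) (g z.1))
    have h2 := abs_sub_le (inner ℝ w (Φ z.1)) (φ z.1) (g z.1)
    have h3 : |inner ℝ w (Φ z.1) - φ z.1| < ε / 2 := hw z.1
    rw [add_zero] at h1
    rw [abs_sub_comm (φ z.1)] at h2
    simp only [add_zero, Real.norm_eq_abs]
    linarith
  rw [integral_add hi2 hd'] at hle
  have hmap : ∫ z : X × SVMLabel, (‖g z.1 - φ z.1‖ + ε / 2) ∂P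
      = ∫ x, (‖g x - φ x‖ + ε / 2) ∂μ :=
    (integral_map measurable_fst.aemeasurable hd.aestronglyMeasurable).symm
  rw [hmap, integral_add hn (integrable_const _)] at hle
  simp only [integral_const, probReal_univ, one_smul] at hle
  unfold hingeRisk at *
  linarith

/-- If, uniformly over balls of radius at least `1 / c m` in the feature space, the empirical
hinge risk tends to the hinge risk, then the risks of SVM minimizers tend to the Bayes risk. -/
lemma tendsto_risk_of_uniform_deviation [TopologicalSpace X] [TopologicalSpace.PseudoMetrizableSpace X]
    [MeasurableSpace X] [BorelSpace X] {Φ : X → H} (huniv : IsUniversal Φ)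
    (P : Measure (X × SVMLabel)) [IsProbabilityMeasure P]
    (hΦ : ∀ w : H, Measurable fun x => inner ℝ w (Φ x)) {κ : ℝ} (hκ₀ : 0 ≤ κ)
    (hκ : ∀ x, ‖Φ x‖ ≤ κ) {c r ε : ℕ → ℝ} (hc : ∀ m, 0 < c m) (hc0 : Tendsto c atTop (𝓝 0))
    (hr : Tendsto r atTop atTop) (hcr : ∀ᶠ m in atTop, 1 / c m ≤ r m)
    (hε : Tendsto ε atTop (𝓝 0)) {z : ℕ → X × SVMLabel}
    (hdev : ∀ᶠ m in atTop, ∀ (w : H) (b : ℝ), ‖w‖ ≤ r m → |b| ≤ 1 + κ * r m →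
      |empiricalHinge Φ m z (w, b) - hingeRisk P fun x => inner ℝ w (Φ x) + b| ≤ ε m)
    {A : Classifier X} (hA : IsKernelSVM Φ c A) :
    Tendsto (fun m : ℕ => risk P (A m fun i => z i)) atTop (𝓝 (bayesRisk P)) := by
  obtain ⟨g₀, hg₀m, hg₀b, hmin, hexc⟩ := exists_bayes_classifier P
  have hbayes : bayesRisk P = risk P g₀ :=
    le_antisymm (iInf₂_le g₀ hg₀m) (le_iInf₂ hmin)
  have hne : ∀ g, risk P g ≠ ∞ := fun g => measure_ne_top _ _
  rw [hbayes, ← ENNReal.tendsto_toReal_iff (fun m => hne _) (hne _)]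
  choose p hp hAp using fun m => hA m fun i => z i
  have hmeas : ∀ (w : H) (b : ℝ), Measurable fun x => inner ℝ w (Φ x) + b :=
    fun w b => (hΦ w).add_const b
  refine tendsto_order.2 ⟨fun a ha => Eventually.of_forall fun m => ha.trans_le ?_, fun a ha => ?_⟩
  · refine ENNReal.toReal_mono (hne _) (hmin _ ?_)
    rw [hAp]
    exact hmeas _ _
  · set e : ℝ := (a - (risk P g₀).toReal) / 2
    have he : 0 < e := half_pos (sub_pos.2 ha)
    -- The competitor `w` is fixed before `m`, so its penalty `c m * ‖w‖` vanishes and `r m`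
    -- eventually exceeds its norm.
    obtain ⟨w, hw⟩ := huniv.exists_hingeRisk_le P hΦ hκ hg₀m hg₀b he
    have hlim : Tendsto (fun m => c m * ‖w‖ + 2 * ε m) atTop (𝓝 0) := by
      simpa using (hc0.mul_const ‖w‖).add (hε.const_mul 2)
    filter_upwards [hdev, hcr, hr.eventually_ge_atTop ‖w‖, hlim.eventually (gt_mem_nhds he)]
      with m hm hcm hwr hsmall
    have hrnn : 0 ≤ r m := (norm_nonneg w).trans hwr
    have hpn : ‖(p m).1‖ ≤ r m := by
      have h1 := (mul_norm_le_svmObjective Φ (c m) (fun i : Fin m => z i) (p m)).trans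
        ((hp m 0).trans (svmObjective_zero_le Φ (c m) fun i : Fin m => z i))
      refine le_trans ?_ hcm
      rw [le_div_iff₀ (hc m)]
      linarith
    -- The deviation bound needs a bounded bias; clipping provides one and leaves the risk
    -- unchanged.
    set b' : ℝ := clip (1 + κ * r m) (p m).2
    set g : X → ℝ := fun x => inner ℝ (p m).1 (Φ x) + b'
    have hb' : |b'| ≤ 1 + κ * r m := abs_clip_le (by positivity) _
    have hrisk : risk P (A m fun i => z i) = risk P g := by
      simp only [risk, hAp, g, b']
      congr 1
      ext z
      have := abs_inner_le_of_norm_le hκ hpn z.1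
      simp only [Set.mem_ofPred_eq]
      rw [labelSign_add_clip (by linarith)]
    have hgB : ∃ B, ∀ x, |g x| ≤ B := ⟨κ * r m + (1 + κ * r m), fun x =>
      (abs_add_le _ _).trans (add_le_add (abs_inner_le_of_norm_le hκ hpn x) hb')⟩
    -- The chain, in hinge risk: `g` is within `ε m` of its empirical value, which is at most `c m *
    -- ‖w‖` plus that of `(w, 0)`, again within `ε m` of the true one, which is at most that of `g₀`
    -- plus `e`.
    have h1 := hexc g (hmeas _ _) hgB
    have h2 := (abs_le.1 (hm (p m).1 b' hpn hb')).1
    have h3 := (abs_le.1 (hm w 0 hwr (by rw [abs_zero]; positivity))).2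
    have h4 := (svmObjective_clip_le Φ hκ (c m) (fun i : Fin m => z i) (p m).1 hpn (p m).2).trans
      (hp m (w, 0))
    rw [svmObjective_eq_add_empiricalHinge, svmObjective_eq_add_empiricalHinge] at h4
    have h5 : 0 ≤ c m * ‖(p m).1‖ := mul_nonneg (hc m).le (norm_nonneg _)
    rw [hrisk]
    have h6 : a = (risk P g₀).toReal + 2 * e := by simp only [e]; ring
    rw [h6]
    simp only [g, b'] at *
    linarith

end Consistency

end

/-! ### Choice of the rate and conclusion. -/

theorem mainTheorem3 {n : ℕ} (X : Set (EuclideanSpace ℝ (Fin n))) (hX : Bornology.IsBounded X)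
    {H : Type*} [NormedAddCommGroup H] [InnerProductSpace ℝ H] [CompleteSpace H]
    (Φ : X → H)
    (hsmooth : IsSmoothKernel X (featureKernel Φ))
    (huniv : IsUniversal Φ) :
    ∃ c₀ : ℕ → ℝ, (∀ m, 0 < c₀ m) ∧ Antitone c₀ ∧ Tendsto c₀ atTop (𝓝 0) ∧
      ∀ c : ℕ → ℝ, (∀ m, 0 < c m) → Tendsto c atTop (𝓝 0) → (∀ᶠ m in atTop, c₀ m ≤ c m) →
        (∃ A : Classifier X, IsKernelSVM Φ c A) ∧
        ∀ A : Classifier X, IsKernelSVM Φ c A → StronglyUniformlyConsistent A := by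
  have hΦu := hsmooth.uniformContinuous
  have htb : TotallyBounded (Set.univ : Set X) := by
    have := hX.isCompact_closure.totallyBounded.subset subset_closure
    refine (totallyBounded_image_iff isUniformEmbedding_subtype_val.isUniformInducing).1 ?_
    simpa using this
  have hΦ : ∀ w : H, Measurable fun x => inner ℝ w (Φ x) := fun w =>
    (continuous_const.inner hΦu.continuous).measurable
  obtain ⟨κ, hκ₀, hκ⟩ := exists_norm_feature_le htb hΦu
  -- On the ball of radius `r = k + 1` this `δ` gives a discretization error `r δ = 1 / r`.
  choose q hq using fun k : ℕ =>
    exists_quantizer htb hΦu (δ := 1 / ((k : ℝ) + 1) ^ 2) (by positivity)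
  -- The fourth power matches the deviation `m ^ (-1/4)`: the number of cells times `r²` stays below
  -- `m ^ (1/4)`, so the frequency error, of order `card * r * m ^ (-1/4)`, is `O(1 / r)`.
  obtain ⟨k, hkmono, hklim, hkN⟩ :=
    exists_slow_growth fun k => ((q k).range.card * (k + 1) ^ 2) ^ 4
  have hrlim : Tendsto (fun m => (k m : ℝ) + 1) atTop atTop :=
    tendsto_atTop_add_const_right _ _ (tendsto_natCast_atTop_atTop.comp hklim)
  refine ⟨fun m => 1 / ((k m : ℝ) + 1), fun m => by positivity, fun a b hab => ?_, ?_,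
    fun c hc hc0 hcc => ⟨?_, fun A hA => ⟨fun m T => ?_, fun P _ => ?_⟩⟩⟩
  · have : (k a : ℝ) ≤ k b := by exact_mod_cast hkmono hab
    exact one_div_le_one_div_of_le (by positivity) (by linarith)
  · simpa [Pi.inv_def] using hrlim.inv_tendsto_atTop
  · choose p hp using fun (m : ℕ) (T : Fin m → X × SVMLabel) =>
      exists_svm_minimizer Φ hκ₀ hκ (hc m) T
    exact ⟨fun m T x => inner ℝ (p m T).1 (Φ x) + (p m T).2, fun m T => ⟨p m T, hp m T, rfl⟩⟩
  · obtain ⟨p, -, hp⟩ := hA m T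
    rw [hp]
    exact (hΦ _).add_const _
  have hcard : ∀ᶠ m in atTop, (q (k m)).range.card ≤ m := by
    filter_upwards [hkN] with m hm
    refine le_trans ?_ hm
    exact (Nat.le_mul_of_pos_right _ (by positivity)).trans (Nat.le_self_pow (by norm_num) _)
  filter_upwards [ae_eventually_freq_dev_lt P (fun m => q (k m)) hcard] with z hz
  refine tendsto_risk_of_uniform_deviation huniv P hΦ hκ₀ hκ hc hc0 hrlim ?_
    (ε := fun m => (4 + 2 * κ) * (1 / ((k m : ℝ) + 1))) ?_ ?_ hA
  · filter_upwards [hcc] with m hm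
    rw [div_le_iff₀ (by positivity)] at hm
    rw [div_le_iff₀ (hc m)]
    linarith
  · simpa [Pi.inv_def] using hrlim.inv_tendsto_atTop.const_mul (4 + 2 * κ)
  · filter_upwards [hz, hkN, eventually_gt_atTop 0] with m hm hN hm0 w b hw hb
    refine (abs_empiricalHinge_sub_hingeRisk_le P hΦ hκ (q (k m)) (hq (k m)) hm0 z
      (fun v hv => (hm v hv).le) hw hb).trans ?_
    set r : ℝ := (k m : ℝ) + 1
    have hr1 : 1 ≤ r := by simp [r]
    have hr0 : 0 < r := by linarith
    set s : ℝ := √√(m : ℝ)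
    have hm' : (0 : ℝ) < m := by exact_mod_cast hm0
    have hs : 0 < s := Real.sqrt_pos.2 (Real.sqrt_pos.2 hm')
    have hcs : (q (k m)).range.card * r ^ 2 ≤ s := by
      have h1 : (((q (k m)).range.card : ℝ) * r ^ 2) ^ 4 ≤ m := by
        simp only [r]
        exact_mod_cast hN
      refine Real.le_sqrt_of_sq_le (Real.le_sqrt_of_sq_le ?_)
      rwa [← pow_mul]
    have hct : (q (k m)).range.card * s⁻¹ ≤ 1 / r ^ 2 := by
      rw [← div_eq_mul_inv, div_le_div_iff₀ hs (by positivity), one_mul]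
      exact hcs
    calc 2 * (r * (1 / r ^ 2)) + (q (k m)).range.card * ((2 + 2 * (κ * r)) * s⁻¹)
        = 2 * (r * (1 / r ^ 2)) + (2 + 2 * (κ * r)) * ((q (k m)).range.card * s⁻¹) := by ring
      _ ≤ 2 * (r * (1 / r ^ 2)) + (2 * r + 2 * (κ * r)) * (1 / r ^ 2) := by
          have : 0 ≤ κ * r := by positivity
          gcongr
          linarith
      _ = (4 + 2 * κ) * (1 / r) := by
          field_simp
          ring
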